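/- Let $p,q$ be positive integers with $2<\frac pq<4$. The circular clique $G_{p,q}$ has vertex set $\{0,1,\dots,p-1\}$, with $u$ and $v$ adjacent if and only if $q\le|u-v|\le p-q$. Let $G$ be a finite simple graph. A $(p,q)$-colouring of $G$ is a homomorphism $f\colon G\to G_{p,q}$. The reconfiguration graph $\mathbf{Col}(G,G_{p,q})$ has the $(p,q)$-colourings of $G$ as its vertices, two of them being adjacent if they differ on at most one vertex of $G$. The graph $G$ is called $(p,q)$-mixing if $\mathbf{Col}(G,G_{p,q})$ is connected, i.e. any two $(p,q)$-colourings of $G$ are joined by a path in it (if $G$ has no $(p,q)$-colouring, this holds vacuously). For a $(p,q)$-colouring $f$ and an edge $uv$ traversed from $u$ to $v$, let $W(uv,f)\in\{0,\dots,p-1\}$ be the residue of $f(v)-f(u)$ modulo $p$. For a cycle $C=c_0,c_1,\dots,c_{l-1},c_l=c_0$ of $G$ with a chosen direction of traversal, let $W(C,f)=\sum_{i=1}^{l}W(c_{i-1}c_i,f)$. This is a multiple of $p$, and the wind of $C$ under $f$ is the integer $w_f(C)$ with $W(C,f)=p\cdot w_f(C)$. Then $G$ is $(p,q)$-mixing if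 and only if $w_f(C)=\frac{|E(C)|}{2}$ for every $(p,q)$-colouring $f$ of $G$ and every cycle $C$ of $G$. Equivalently, $G$ is not $(p,q)$-mixing if and only if there are a $(p,q)$-colouring $f$ of $G$ and a cycle $C$ of $G$ with $W(C,f)\ne\frac{|E(C)|}{2}\,p$. -/

import Mathlib

namespace CircularMixing

/-- The circular clique `G_{p,q}` on `{0, …, p-1}`: `u` and `v` are adjacent iff
`q ≤ |u - v| ≤ p - q`. For `q ≥ 1` the clause `u ≠ v` is redundant. -/
def circularClique (p q : ℕ) : SimpleGraph (Fin p) where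
  Adj u v := u ≠ v ∧ (q : ℤ) ≤ |(u : ℤ) - (v : ℤ)| ∧ |(u : ℤ) - (v : ℤ)| ≤ (p : ℤ) - (q : ℤ)
  symm := ⟨fun u v h => by rwa [ne_comm, abs_sub_comm] at h⟩
  loopless := ⟨fun _ h => h.1 rfl⟩

/-- A `(p,q)`-colouring of `G` is a homomorphism from `G` to the circular clique `G_{p,q}`. -/
abbrev Colouring {V : Type*} (G : SimpleGraph V) (p q : ℕ) : Type _ :=
  G →g circularClique p q

/-- The reconfiguration graph `Col(G, H)`: its vertices are the homomorphisms from `G` to `H`,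
and two of them are adjacent iff they differ on at most one vertex of `G`. Loops are left out,
which does not affect paths or connectedness. -/
def reconfigurationGraph {V W : Type*} (G : SimpleGraph V) (H : SimpleGraph W) :
    SimpleGraph (G →g H) where
  Adj f g := f ≠ g ∧ {v | f v ≠ g v}.Subsingleton
  symm := ⟨fun f g h => ⟨h.1.symm, by simpa only [ne_comm] using h.2⟩⟩
  loopless := ⟨fun _ h => h.1 rfl⟩

/-- `G` is `(p,q)`-mixing: any two `(p,q)`-colourings of `G` are joined by a path in
`Col(G, G_{p,q})`. The graph without vertices thus counts as connected; for a graph `G` that has a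
`(p,q)`-colouring this is `SimpleGraph.Connected`, see `isMixing_iff_connected`. -/
def IsMixing {V : Type*} (G : SimpleGraph V) (p q : ℕ) : Prop :=
  (reconfigurationGraph G (circularClique p q)).Preconnected

theorem isMixing_iff_connected {V : Type*} (G : SimpleGraph V) (p q : ℕ)
    [h : Nonempty (Colouring G p q)] :
    IsMixing G p q ↔ (reconfigurationGraph G (circularClique p q)).Connected :=
  ⟨fun hG => ⟨hG⟩, fun hG => hG.preconnected⟩

/-- The weight `W(uv, f) = (f(v) - f(u)) mod p`, an integer in `{0, …, p-1}`. -/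
def edgeWeight {V : Type*} {p : ℕ} (f : V → Fin p) (u v : V) : ℤ :=
  ((f v : ℤ) - (f u : ℤ)) % (p : ℤ)

/-- The weight `W(X, f)` of a walk: the sum of the weights of its edges, each in the direction in
which the walk traverses it. -/
def walkWeight {V : Type*} {G : SimpleGraph V} {p : ℕ} (f : V → Fin p) {u v : V}
    (X : G.Walk u v) : ℤ :=
  (X.darts.map fun d => edgeWeight f d.fst d.snd).sum

/-- The wind `w_f(C)` of a closed walk, the integer with `W(C, f) = p * w_f(C)`
(see `walkWeight_eq_mul_wind`: the division is exact). -/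
def wind {V : Type*} {G : SimpleGraph V} {p : ℕ} (f : V → Fin p) {u : V}
    (C : G.Walk u u) : ℤ :=
  walkWeight f C / (p : ℤ)

theorem walkWeight_modEq {V : Type*} {G : SimpleGraph V} {p : ℕ} (f : V → Fin p) {u v : V}
    (X : G.Walk u v) : walkWeight f X ≡ (f v : ℤ) - (f u : ℤ) [ZMOD p] := by
  induction X with
  | nil => simp [walkWeight]
  | @cons a b c h X ih =>
    have e : walkWeight f (SimpleGraph.Walk.cons h X) = edgeWeight f a b + walkWeight f X := by
      simp [walkWeight]
    have hb : edgeWeight f a b ≡ (f b : ℤ) - (f a : ℤ) [ZMOD p] := Int.mod_modEq _ _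
    rw [e]
    convert hb.add ih using 1
    ring

theorem walkWeight_eq_mul_wind {V : Type*} {G : SimpleGraph V} {p : ℕ} (f : V → Fin p) {u : V}
    (C : G.Walk u u) : walkWeight f C = (p : ℤ) * wind f C := by
  have h := walkWeight_modEq f C
  rw [sub_self] at h
  exact (Int.mul_ediv_cancel' (Int.modEq_zero_iff_dvd.mp h)).symm

end CircularMixing

/-!
Write `W(uv, f) = f v - f u + p * wrap f u v` with `wrap f u v ∈ {0, 1}`, so that the wind of a
closed walk counts the edges along which `f` wraps around `0`.

Since `p < 4 q`, recolouring one vertex changes the edge weights by a coboundary, so winds are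
constant on the components of the reconfiguration graph. Reflecting the colours replaces `w_f(C)`
by `|E(C)| - w_f(C)`, so mixing forces both to be `|E(C)| / 2`.

Conversely, if `f` and `g` have the same winds, then they lift to integer functions that solve the
same system of difference constraints `F v ≤ F u + b u v`. The solutions are closed under pointwise
maxima, and if the system has a strict real solution, one can climb from `F` to `F ⊔ F'` by
raising one value at a time: among the values still to be raised, take the one that is lowest
relative to the strict solution. If all winds are `|E(C)| / 2`, giving every edge the weight `p / 2`
is such a strict solution, as `q < p / 2 < p - q`.
-/

namespace CircularMixing

open SimpleGraph

section DartSum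

variable {V A : Type*} {G : SimpleGraph V} {u v x : V}

/-- The sum of the weights `w` along a walk, each edge being taken in the direction of traversal;
`walkWeight f` is `dartSum (edgeWeight f)`. -/
def dartSum [AddMonoid A] (w : V → V → A) (X : G.Walk u v) : A :=
  (X.darts.map fun d => w d.fst d.snd).sum

section AddMonoid

variable [AddMonoid A] (w : V → V → A)

@[simp]
theorem dartSum_nil : dartSum w (Walk.nil : G.Walk u u) = 0 := rfl

@[simp]
theorem dartSum_cons (h : G.Adj u v) (X : G.Walk v x) :
    dartSum w (Walk.cons h X) = w u v + dartSum w X := by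
  simp [dartSum]

@[simp]
theorem dartSum_append (X : G.Walk u v) (Y : G.Walk v x) :
    dartSum w (X.append Y) = dartSum w X + dartSum w Y := by
  simp [dartSum]

@[simp]
theorem dartSum_copy {u' v' : V} (X : G.Walk u v) (hu : u = u') (hv : v = v') :
    dartSum w (X.copy hu hv) = dartSum w X := by
  simp [dartSum]

theorem dartSum_const (a : A) (X : G.Walk u v) : dartSum (fun _ _ => a) X = X.length • a := by
  simp [dartSum]

theorem dartSum_congr {w w' : V → V → A} (h : ∀ u v, G.Adj u v → w u v = w' u v)
    (X : G.Walk u v) : dartSum w X = dartSum w' X :=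
  congrArg List.sum (List.map_congr_left fun d _ => h _ _ d.adj)

end AddMonoid

theorem dartSum_add [AddCommMonoid A] (w w' : V → V → A) (X : G.Walk u v) :
    dartSum (fun a b => w a b + w' a b) X = dartSum w X + dartSum w' X :=
  List.sum_map_add

theorem dartSum_sub [AddCommGroup A] (w w' : V → V → A) (X : G.Walk u v) :
    dartSum (fun a b => w a b - w' a b) X = dartSum w X - dartSum w' X := by
  rw [eq_sub_iff_add_eq, ← dartSum_add]
  simp only [sub_add_cancel]

theorem dartSum_mul_left [NonUnitalNonAssocSemiring A] (a : A) (w : V → V → A) (X : G.Walk u v) :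
    dartSum (fun b c => a * w b c) X = a * dartSum w X :=
  List.sum_map_mul_left ..

theorem dartSum_coboundary [AddCommGroup A] (φ : V → A) (X : G.Walk u v) :
    dartSum (fun a b => φ b - φ a) X = φ v - φ u := by
  induction X with
  | nil => simp
  | cons _ _ ih => rw [dartSum_cons, ih, add_comm, sub_add_sub_cancel]

end DartSum

section Potential

variable {V A : Type*} {G : SimpleGraph V} [AddGroup A] {w : V → V → A} {u v : V}

theorem dartSum_reverse (hw : ∀ u v, G.Adj u v → w u v + w v u = 0) (X : G.Walk u v) :
    dartSum w X.reverse = -dartSum w X := by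
  induction X with
  | nil => simp
  | cons h X ih =>
    rw [Walk.reverse_cons, dartSum_append, ih, dartSum_cons, dartSum_cons, dartSum_nil, add_zero,
      neg_add_rev, eq_neg_of_add_eq_zero_right (hw _ _ h)]

/-- The closed walk is either a cycle or a single edge traversed back and forth. -/
theorem dartSum_cons_eq_zero_of_isPath (hw : ∀ u v, G.Adj u v → w u v + w v u = 0)
    (hC : ∀ c (C : G.Walk c c), C.IsCycle → dartSum w C = 0) (h : G.Adj u v)
    {P : G.Walk v u} (hP : P.IsPath) : dartSum w (Walk.cons h P) = 0 := by
  by_cases he : s(u, v) ∈ P.edges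
  · rw [hP.eq_adj_toWalk_of_mem_edges (Sym2.eq_swap ▸ he)]
    simpa using hw u v h
  · exact hC _ _ ((Walk.cons_isCycle_iff _ h).2 ⟨hP, he⟩)

theorem dartSum_bypass [DecidableEq V] (hw : ∀ u v, G.Adj u v → w u v + w v u = 0)
    (hC : ∀ c (C : G.Walk c c), C.IsCycle → dartSum w C = 0) (X : G.Walk u v) :
    dartSum w X.bypass = dartSum w X := by
  induction X with
  | nil => rfl
  | @cons a b c h X ih =>
    rw [Walk.bypass, dartSum_cons, ← ih]
    split_ifs with ha
    · have hzero : w a b + dartSum w (X.bypass.takeUntil a ha) = 0 := by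
        rw [← dartSum_cons w h]
        exact dartSum_cons_eq_zero_of_isPath hw hC h (X.bypass_isPath.takeUntil ha)
      conv_rhs => rw [← X.bypass.take_spec ha, dartSum_append, ← add_assoc, hzero, zero_add]
    · rw [dartSum_cons]

theorem dartSum_eq_zero_of_forall_isCycle (hw : ∀ u v, G.Adj u v → w u v + w v u = 0)
    (hC : ∀ c (C : G.Walk c c), C.IsCycle → dartSum w C = 0) (X : G.Walk u u) :
    dartSum w X = 0 := by
  classical
  rw [← dartSum_bypass hw hC, (Walk.isPath_iff_nil.1 X.bypass_isPath).eq_nil, dartSum_nil]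

theorem dartSum_eq_of_forall_isCycle (hw : ∀ u v, G.Adj u v → w u v + w v u = 0)
    (hC : ∀ c (C : G.Walk c c), C.IsCycle → dartSum w C = 0) (X Y : G.Walk u v) :
    dartSum w X = dartSum w Y := by
  have h := dartSum_eq_zero_of_forall_isCycle hw hC (X.append Y.reverse)
  rwa [dartSum_append, dartSum_reverse hw, add_neg_eq_zero] at h

theorem exists_potential_of_forall_isCycle (hw : ∀ u v, G.Adj u v → w u v + w v u = 0)
    (hC : ∀ c (C : G.Walk c c), C.IsCycle → dartSum w C = 0) :
    ∃ φ : V → A, ∀ u v, G.Adj u v → φ v = φ u + w u v := by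
  let root (v : V) : V := (G.connectedComponentMk v).out
  have hroot {u v : V} (h : G.Adj u v) : root u = root v :=
    congrArg Quot.out (ConnectedComponent.sound h.reachable)
  let X (v : V) : G.Walk (root v) v := (ConnectedComponent.exact (Quot.out_eq _)).some
  refine ⟨fun v => dartSum w (X v), fun u v h => ?_⟩
  calc dartSum w (X v)
      = dartSum w (((X u).append h.toWalk).copy (hroot h) rfl) :=
        dartSum_eq_of_forall_isCycle hw hC _ _
    _ = dartSum w (X u) + w u v := by simp

end Potential

section EdgeWeight

variable {V : Type*} {G : SimpleGraph V} {p q : ℕ} {u v : V}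

/-- `1` if the colours pass from `p - 1` to `0` when they are increased cyclically from `f u` to
`f v`, and `0` otherwise. -/
def wrap (f : V → Fin p) (u v : V) : ℤ :=
  if f v < f u then 1 else 0

theorem edgeWeight_eq_sub_add_wrap (f : V → Fin p) (u v : V) :
    edgeWeight f u v = (f v - f u : ℤ) + p * wrap f u v := by
  have hu := (f u).isLt
  have hv := (f v).isLt
  simp only [edgeWeight, wrap, Fin.lt_def]
  split_ifs
  · rw [← Int.add_emod_right, Int.emod_eq_of_lt] <;> omega
  · rw [Int.emod_eq_of_lt] <;> omega

theorem wrap_add_wrap_swap {f : V → Fin p} (h : f u ≠ f v) : wrap f u v + wrap f v u = 1 := by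
  rcases h.lt_or_gt with h | h <;> simp [wrap, h, h.not_gt]

theorem edgeWeight_add_edgeWeight_swap {f : V → Fin p} (h : f u ≠ f v) :
    edgeWeight f u v + edgeWeight f v u = p := by
  rw [edgeWeight_eq_sub_add_wrap, edgeWeight_eq_sub_add_wrap]
  linear_combination (p : ℤ) * wrap_add_wrap_swap h

theorem wind_eq_dartSum_wrap (f : V → Fin p) (X : G.Walk u u) :
    wind f X = dartSum (wrap f) X := by
  have hp : (p : ℤ) ≠ 0 := mod_cast (f u).pos.ne'
  apply mul_left_cancel₀ hp
  calc p * wind f X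
      = dartSum (edgeWeight f) X := (walkWeight_eq_mul_wind f X).symm
    _ = dartSum (fun a b => (f b - f a : ℤ) + p * wrap f a b) X :=
        dartSum_congr (fun a b _ => edgeWeight_eq_sub_add_wrap f a b) X
    _ = p * dartSum (wrap f) X := by
        rw [dartSum_add, dartSum_coboundary fun v => (f v : ℤ), dartSum_mul_left, sub_self,
          zero_add]

theorem circularClique_adj_iff {a b : Fin p} :
    (circularClique p q).Adj a b ↔ a ≠ b ∧ ((b : ℤ) - a) % p ∈ Set.Icc (q : ℤ) (p - q) := by
  have h := edgeWeight_eq_sub_add_wrap id a b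
  simp only [edgeWeight, wrap, id, Fin.lt_def] at h
  simp only [circularClique, Set.mem_Icc, ne_eq, Fin.ext_iff]
  grind

theorem Colouring.edgeWeight_mem_Icc (f : Colouring G p q) (h : G.Adj u v) :
    edgeWeight f u v ∈ Set.Icc (q : ℤ) (p - q) :=
  (circularClique_adj_iff.1 (f.map_adj h)).2

end EdgeWeight

section Invariance

variable {V : Type*} {G : SimpleGraph V} {p q : ℕ} {u v : V}

/-- Both weights lie in an interval of length `p - 2 * q < p / 2`, so their difference is a
balanced residue. -/
theorem Colouring.edgeWeight_sub_edgeWeight (hpq : p < 4 * q) (f g : Colouring G p q)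
    (h : G.Adj u v) :
    edgeWeight g u v - edgeWeight f u v = Int.bmod ((g v - f v : ℤ) - (g u - f u)) p := by
  obtain ⟨hf₁, hf₂⟩ := f.edgeWeight_mem_Icc h
  obtain ⟨hg₁, hg₂⟩ := g.edgeWeight_mem_Icc h
  have hdiff : (g v - f v : ℤ) - (g u - f u) =
      edgeWeight g u v - edgeWeight f u v + p * (wrap f u v - wrap g u v) := by
    rw [edgeWeight_eq_sub_add_wrap, edgeWeight_eq_sub_add_wrap]
    ring
  rw [hdiff, Int.add_mul_bmod_self_left, Int.bmod_eq_of_le_mul_two] <;> omega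

theorem Colouring.edgeWeight_eq_add_coboundary (hpq : p < 4 * q)
    {f g : Colouring G p q} (hfg : {v | f v ≠ g v}.Subsingleton) (h : G.Adj u v) :
    edgeWeight g u v =
      edgeWeight f u v + (Int.bmod (g v - f v : ℤ) p - Int.bmod (g u - f u : ℤ) p) := by
  have hsame : f u = g u ∨ f v = g v := by
    by_contra! hne
    exact h.ne (hfg hne.1 hne.2)
  rcases hsame with hu | hv
  · have huv := f.edgeWeight_sub_edgeWeight hpq g h
    simp only [hu, sub_self, sub_zero, Int.zero_bmod] at huv ⊢
    linarith
  · have hvu := f.edgeWeight_sub_edgeWeight hpq g h.symm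
    simp only [hv, sub_self, sub_zero, Int.zero_bmod] at hvu ⊢
    linarith [edgeWeight_add_edgeWeight_swap (f.map_adj h).ne,
      edgeWeight_add_edgeWeight_swap (g.map_adj h).ne]

theorem walkWeight_eq_of_subsingleton_ne (hpq : p < 4 * q) {f g : Colouring G p q}
    (hfg : {v | f v ≠ g v}.Subsingleton) (X : G.Walk u u) : walkWeight f X = walkWeight g X := by
  symm
  calc walkWeight g X
      = dartSum (fun a b => edgeWeight f a b +
          (Int.bmod (g b - f b : ℤ) p - Int.bmod (g a - f a : ℤ) p)) X :=
        dartSum_congr (fun _ _ => Colouring.edgeWeight_eq_add_coboundary hpq hfg) X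
    _ = dartSum (edgeWeight f) X := by
        rw [dartSum_add, dartSum_coboundary fun v => Int.bmod (g v - f v : ℤ) p, sub_self,
          add_zero]
    _ = walkWeight f X := rfl

theorem walkWeight_eq_of_reachable (hpq : p < 4 * q) {f g : Colouring G p q}
    (h : (reconfigurationGraph G (circularClique p q)).Reachable f g) (X : G.Walk u u) :
    walkWeight f X = walkWeight g X := by
  obtain ⟨P⟩ := h
  induction P with
  | nil => rfl
  | cons hadj _ ih => exact (walkWeight_eq_of_subsingleton_ne hpq hadj.2 X).trans ih

/-- The reflection `a ↦ p - 1 - a` of the circular clique. -/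
def circularCliqueRev (p q : ℕ) : circularClique p q →g circularClique p q where
  toFun := Fin.rev
  map_rel' {a b} h := by
    have hrev : (a.rev - b.rev : ℤ) = b - a := by
      simp only [Fin.val_rev]
      omega
    refine ⟨Fin.rev_injective.ne h.1, ?_⟩
    rw [hrev, abs_sub_comm]
    exact h.2

theorem edgeWeight_rev_comp (f : V → Fin p) (u v : V) :
    edgeWeight (fun x => (f x).rev) u v = edgeWeight f v u := by
  simp only [edgeWeight, Fin.val_rev]
  congr 1
  omega

theorem Colouring.walkWeight_add_walkWeight_rev (f : Colouring G p q) (X : G.Walk u v) :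
    walkWeight f X + walkWeight ((circularCliqueRev p q).comp f) X = X.length * p := by
  calc walkWeight f X + walkWeight ((circularCliqueRev p q).comp f) X
      = dartSum (fun a b => edgeWeight f a b + edgeWeight (fun x => (f x).rev) a b) X :=
        (dartSum_add ..).symm
    _ = dartSum (fun _ _ => (p : ℤ)) X := dartSum_congr (fun a b h => by
        rw [edgeWeight_rev_comp, edgeWeight_add_edgeWeight_swap (f.map_adj h).ne]) X
    _ = X.length * p := by rw [dartSum_const, nsmul_eq_mul]

theorem IsMixing.two_mul_wind (hpq : p < 4 * q) (hG : IsMixing G p q)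
    (f : Colouring G p q) (X : G.Walk u u) : 2 * wind f X = X.length := by
  have hp : (p : ℤ) ≠ 0 := mod_cast (f u).pos.ne'
  have hrev := walkWeight_eq_of_reachable hpq (hG f ((circularCliqueRev p q).comp f)) X
  have hsum := f.walkWeight_add_walkWeight_rev X
  rw [← hrev, walkWeight_eq_mul_wind] at hsum
  apply mul_left_cancel₀ hp
  linarith

end Invariance

section DifferenceConstraints

variable {V : Type*} {r : V → V → Prop} {b : V → V → ℤ} {F F' : V → ℤ} {π : V → ℝ}

/-- `F` solves the system of difference constraints `F v - F u ≤ b u v`, one for each pair with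
`r u v`. -/
def IsFeasible (r : V → V → Prop) (b : V → V → ℤ) (F : V → ℤ) : Prop :=
  ∀ u v, r u v → F v ≤ F u + b u v

/-- The graph on the solutions of a system of difference constraints in which two solutions are
adjacent if they differ at exactly one point. -/
def feasibleGraph (r : V → V → Prop) (b : V → V → ℤ) :
    SimpleGraph {F : V → ℤ // IsFeasible r b F} where
  Adj F F' := F ≠ F' ∧ {v | F.1 v ≠ F'.1 v}.Subsingleton
  symm := ⟨fun F F' h => ⟨h.1.symm, by simpa only [ne_comm] using h.2⟩⟩
  loopless := ⟨fun _ h => h.1 rfl⟩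

namespace IsFeasible

theorem sup (hF : IsFeasible r b F) (hF' : IsFeasible r b F') : IsFeasible r b (F ⊔ F') :=
  fun u v h => sup_le
    ((hF u v h).trans (add_le_add_left le_sup_left _))
    ((hF' u v h).trans (add_le_add_left le_sup_right _))

theorem exists_update [DecidableEq V] (hπ : ∀ u v, r u v → π v < π u + b u v)
    (hF : IsFeasible r b F) (hF' : IsFeasible r b F') (hfin : {v | F v < F' v}.Finite)
    (hlt : ∃ v, F v < F' v) :
    ∃ v, F v < F' v ∧ IsFeasible r b (Function.update F v (F v + 1)) := by
  obtain ⟨v, hv, hmin⟩ :=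
    Set.exists_min_image {v | F v < F' v} (fun v => (F v - π v : ℝ)) hfin hlt
  have hv : F v < F' v := hv
  have hslack (u : V) (h : r u v) : F v + 1 ≤ F u + b u v := by
    rcases lt_or_ge (F u) (F' u) with hu | hu
    · have hstrict : (F v : ℝ) < F u + b u v := by linarith [hmin u hu, hπ u v h]
      exact Int.add_one_le_of_lt (mod_cast hstrict)
    · linarith [hF' u v h, Int.add_one_le_of_lt hv]
  have hle : F ≤ Function.update F v (F v + 1) := by simp
  refine ⟨v, hv, fun a c h => ?_⟩
  rcases eq_or_ne c v with rfl | hc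
  · rw [Function.update_self]
    exact (hslack a h).trans (add_le_add_left (hle a) _)
  · rw [Function.update_of_ne hc]
    exact (hF a c h).trans (add_le_add_left (hle a) _)

theorem adj_update [DecidableEq V] {v : V} {z : ℤ} (hz : F v ≠ z) (hF : IsFeasible r b F)
    (hFv : IsFeasible r b (Function.update F v z)) :
    (feasibleGraph r b).Adj ⟨F, hF⟩ ⟨Function.update F v z, hFv⟩ := by
  refine ⟨fun h => hz ?_, Set.subsingleton_singleton.anti (t := {v}) fun u hu => ?_⟩
  · simpa using congrFun (congrArg Subtype.val h) v
  · by_contra huv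
    exact hu (Function.update_of_ne huv _ _).symm

theorem reachable_of_le (hπ : ∀ u v, r u v → π v < π u + b u v)
    (hF : IsFeasible r b F) (hF' : IsFeasible r b F') (hfin : {v | F v < F' v}.Finite)
    (hle : F ≤ F') : (feasibleGraph r b).Reachable ⟨F, hF⟩ ⟨F', hF'⟩ := by
  classical
  obtain ⟨s, hs⟩ : ∃ s : Finset V, ∀ v, F v < F' v → v ∈ s := ⟨hfin.toFinset, by simp⟩
  clear hfin
  induction hn : ∑ v ∈ s, (F' v - F v).toNat using Nat.strong_induction_on generalizing F with
  | _ n ih =>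
    by_cases hlt : ∃ v, F v < F' v
    · obtain ⟨v, hv, hFv⟩ := exists_update hπ hF hF' (s.finite_toSet.subset hs) hlt
      have hge : F ≤ Function.update F v (F v + 1) := by simp
      have hsum : ∑ u ∈ s, (F' u - Function.update F v (F v + 1) u).toNat < n := by
        rw [← hn]
        refine Finset.sum_lt_sum (fun u _ => ?_) ⟨v, hs v hv, ?_⟩
        · exact Int.toNat_le_toNat (sub_le_sub_left (hge u) _)
        · rw [Function.update_self]
          omega
      exact (adj_update (by omega) hF hFv).reachable.trans <|
        ih _ hsum hFv (update_le_iff.2 ⟨hv, fun u _ => hle u⟩)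
          (fun u hu => hs u ((hge u).trans_lt hu)) rfl
    · obtain rfl : F = F' := le_antisymm hle fun v => not_lt.1 fun h => hlt ⟨v, h⟩
      rfl

theorem reachable (hπ : ∀ u v, r u v → π v < π u + b u v) (hF : IsFeasible r b F)
    (hF' : IsFeasible r b F') (hfin : {v | F v ≠ F' v}.Finite) :
    (feasibleGraph r b).Reachable ⟨F, hF⟩ ⟨F', hF'⟩ := by
  have hsup : {v | F v < (F ⊔ F') v}.Finite :=
    hfin.subset fun v hv => ((lt_sup_iff.1 hv).resolve_left (lt_irrefl _)).ne
  have hsup' : {v | F' v < (F ⊔ F') v}.Finite :=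
    hfin.subset fun v hv => ((lt_sup_iff.1 hv).resolve_right (lt_irrefl _)).ne'
  exact (hF.reachable_of_le hπ (hF.sup hF') hsup le_sup_left).trans
    (hF'.reachable_of_le hπ (hF.sup hF') hsup' le_sup_right).symm

end IsFeasible

end DifferenceConstraints

section Lift

variable {V : Type*} {G : SimpleGraph V} {p q : ℕ} {c : V → V → ℤ} {F : V → ℤ}

/-- The residue of an integer modulo `p`, as an element of `Fin p`. -/
def residue (p : ℕ) [NeZero p] (a : ℤ) : Fin p :=
  ⟨(a % p).toNat, by
    have := NeZero.pos p
    have := Int.emod_lt_of_pos a (b := p) (by omega)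
    omega⟩

theorem coe_residue (p : ℕ) [NeZero p] (a : ℤ) : (residue p a : ℤ) = a % p :=
  Int.toNat_of_nonneg (Int.emod_nonneg a (mod_cast NeZero.ne p))

theorem residue_coe_add_mul [NeZero p] (a : Fin p) (k : ℤ) : residue p (a + p * k) = a := by
  rw [Fin.ext_iff, ← Int.natCast_inj, coe_residue, Int.add_mul_emod_self_left,
    Int.emod_eq_of_lt] <;> omega

/-- The bounds for the integer lifts `F` of those `(p,q)`-colourings for which the weight of the
edge `uv` is `F v - F u + p * c u v`: since `c u v + c v u = 1`, the constraints for `uv` and for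
`vu` together place this weight between `q` and `p - q`. -/
def liftBound (p q : ℕ) (c : V → V → ℤ) (u v : V) : ℤ :=
  p - q - p * c u v

/-- The reduction modulo `p` of a function that satisfies the constraints `liftBound p q c`. -/
def IsFeasible.colouring [NeZero p] (hq : 0 < q) (hc : ∀ u v, G.Adj u v → c u v + c v u = 1)
    (hF : IsFeasible G.Adj (liftBound p q c) F) : Colouring G p q where
  toFun v := residue p (F v)
  map_rel' {u v} h := by
    have huv := hF u v h
    have hvu := hF v u h.symm
    rw [liftBound, eq_sub_of_add_eq' (hc u v h)] at hvu
    rw [liftBound] at huv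
    have hmem : ((residue p (F v) : ℤ) - residue p (F u)) % p ∈ Set.Icc (q : ℤ) (p - q) := by
      rw [coe_residue, coe_residue, ← Int.sub_emod, ← Int.add_mul_emod_self_left _ _ (c u v),
        Int.emod_eq_of_lt]
      · constructor <;> linarith
      all_goals linarith
    refine circularClique_adj_iff.2 ⟨fun h => ?_, hmem⟩
    rw [h, sub_self, Int.zero_emod] at hmem
    exact hmem.1.not_gt (mod_cast hq)

theorem Colouring.isFeasible_liftBound (f : Colouring G p q) {k : V → ℤ}
    (hk : ∀ u v, G.Adj u v → k v = k u + (wrap f u v - c u v)) :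
    IsFeasible G.Adj (liftBound p q c) fun v => f v + p * k v := by
  intro u v h
  have hweight := (f.edgeWeight_mem_Icc h).2
  rw [edgeWeight_eq_sub_add_wrap] at hweight
  simp only [liftBound, hk u v h]
  linarith

theorem reachable_of_subsingleton_ne {W : Type*} {H : SimpleGraph W} {f g : G →g H}
    (h : {v | f v ≠ g v}.Subsingleton) : (reconfigurationGraph G H).Reachable f g := by
  rcases eq_or_ne f g with rfl | hne
  · rfl
  · exact Adj.reachable ⟨hne, h⟩

theorem reachable_colouring_of_reachable [NeZero p] (hq : 0 < q)
    (hc : ∀ u v, G.Adj u v → c u v + c v u = 1)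
    {F F' : {F // IsFeasible G.Adj (liftBound p q c) F}}
    (h : (feasibleGraph G.Adj (liftBound p q c)).Reachable F F') :
    (reconfigurationGraph G (circularClique p q)).Reachable
      (F.2.colouring hq hc) (F'.2.colouring hq hc) := by
  obtain ⟨P⟩ := h
  induction P with
  | nil => rfl
  | cons hadj _ ih =>
    refine (reachable_of_subsingleton_ne (hadj.2.anti fun v hv h => hv ?_)).trans ih
    exact congrArg (residue p) h

theorem Colouring.exists_lt_add_liftBound (hpq : 2 * q < p) (f : Colouring G p q)
    (hf : ∀ u (C : G.Walk u u), C.IsCycle → 2 * wind f C = C.length) :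
    ∃ π : V → ℝ, ∀ u v, G.Adj u v → π v < π u + liftBound p q (wrap f) u v := by
  obtain ⟨κ, hκ⟩ : ∃ κ : V → ℤ, ∀ u v, G.Adj u v → κ v = κ u + (1 - 2 * wrap f u v) := by
    refine exists_potential_of_forall_isCycle (fun u v h => ?_) fun u C hC => ?_
    · linarith [wrap_add_wrap_swap (f.map_adj h).ne]
    · rw [dartSum_sub, dartSum_const, dartSum_mul_left, ← wind_eq_dartSum_wrap, hf u C hC]
      simp
  refine ⟨fun v => p * κ v / 2, fun u v h => ?_⟩
  have hpq' : (2 * q : ℝ) < p := mod_cast hpq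
  simp only [liftBound, hκ u v h]
  push_cast
  linarith

theorem Colouring.exists_wrap_potential {f g : Colouring G p q}
    (hfg : ∀ u (C : G.Walk u u), C.IsCycle → wind f C = wind g C) :
    ∃ k : V → ℤ, ∀ u v, G.Adj u v → k v = k u + (wrap g u v - wrap f u v) := by
  refine exists_potential_of_forall_isCycle (fun u v h => ?_) fun u C hC => ?_
  · linarith [wrap_add_wrap_swap (f.map_adj h).ne, wrap_add_wrap_swap (g.map_adj h).ne]
  · rw [dartSum_sub, ← wind_eq_dartSum_wrap, ← wind_eq_dartSum_wrap, hfg u C hC, sub_self]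

theorem reachable_of_wind_eq [Finite V] (hq : 0 < q) (hpq : 2 * q < p) {f g : Colouring G p q}
    (hf : ∀ u (C : G.Walk u u), C.IsCycle → 2 * wind f C = C.length)
    (hfg : ∀ u (C : G.Walk u u), C.IsCycle → wind f C = wind g C) :
    (reconfigurationGraph G (circularClique p q)).Reachable f g := by
  have : NeZero p := ⟨by omega⟩
  have hwrap (u v : V) (h : G.Adj u v) : wrap f u v + wrap f v u = 1 :=
    wrap_add_wrap_swap (f.map_adj h).ne
  obtain ⟨π, hπ⟩ := f.exists_lt_add_liftBound hpq hf
  obtain ⟨k, hk⟩ := Colouring.exists_wrap_potential hfg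
  have hF := f.isFeasible_liftBound (c := wrap f) (k := 0) (by simp)
  have hF' := g.isFeasible_liftBound hk
  have hfF : hF.colouring hq hwrap = f := RelHom.ext fun v => residue_coe_add_mul (f v) 0
  have hgF' : hF'.colouring hq hwrap = g := RelHom.ext fun v => residue_coe_add_mul (g v) (k v)
  rw [← hfF, ← hgF']
  exact reachable_colouring_of_reachable hq hwrap (hF.reachable hπ hF' (Set.toFinite _))

end Lift

section Mixing

variable {V : Type*} {G : SimpleGraph V} {p q : ℕ}

theorem isMixing_iff_forall_two_mul_wind [Finite V] (hpq₂ : 2 * q < p) (hpq₄ : p < 4 * q) :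
    IsMixing G p q ↔ ∀ (f : Colouring G p q) (c : V) (C : G.Walk c c), C.IsCycle →
      2 * wind f C = C.length := by
  refine ⟨fun h f c C _ => h.two_mul_wind hpq₄ f C, fun h f g => ?_⟩
  refine reachable_of_wind_eq (by omega) hpq₂ (h f) fun c C hC => ?_
  linarith [h f c C hC, h g c C hC]

theorem wind_eq_length_div_two_iff (f : V → Fin p) {u : V} (X : G.Walk u u) :
    (wind f X : ℚ) = X.length / 2 ↔ 2 * wind f X = X.length := by
  rw [eq_div_iff two_ne_zero, mul_comm]
  norm_cast

theorem walkWeight_eq_length_div_two_mul_iff (f : V → Fin p) {u : V} (X : G.Walk u u) :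
    (walkWeight f X : ℚ) = X.length / 2 * p ↔ 2 * wind f X = X.length := by
  rw [walkWeight_eq_mul_wind, Int.cast_mul, Int.cast_natCast, mul_comm,
    mul_left_inj' (mod_cast (f u).pos.ne'), wind_eq_length_div_two_iff]

end Mixing

end CircularMixing

theorem theorem2p3 {V : Type*} [Finite V] (G : SimpleGraph V) (p q : ℕ)
    (hpq₂ : (2 : ℚ) < (p : ℚ) / (q : ℚ)) (hpq₄ : (p : ℚ) / (q : ℚ) < 4) :
    (CircularMixing.IsMixing G p q ↔
      ∀ (f : CircularMixing.Colouring G p q) (c : V) (C : G.Walk c c), C.IsCycle →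
        (CircularMixing.wind f C : ℚ) = (C.length : ℚ) / 2) ∧
    (¬ CircularMixing.IsMixing G p q ↔
      ∃ (f : CircularMixing.Colouring G p q) (c : V) (C : G.Walk c c), C.IsCycle ∧
        (CircularMixing.walkWeight f C : ℚ) ≠ (C.length : ℚ) / 2 * (p : ℚ)) := by
  have hq : (0 : ℚ) < q := Nat.cast_pos.2 (Nat.pos_of_ne_zero fun h => by norm_num [h] at hpq₂)
  have h₂ : 2 * q < p := mod_cast (lt_div_iff₀ hq).1 hpq₂
  have h₄ : p < 4 * q := mod_cast (div_lt_iff₀ hq).1 hpq₄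
  rw [CircularMixing.isMixing_iff_forall_two_mul_wind h₂ h₄]
  constructor
  · simp only [CircularMixing.wind_eq_length_div_two_iff]
  · simp only [ne_eq, CircularMixing.walkWeight_eq_length_div_two_mul_iff, not_forall, exists_prop]
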